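/- Let $n \ge 0$ be an integer and let $\mathbb{C}_n[t]$ be the set of monic complex polynomials of degree $n$, with the metric induced by $\|Q\| = \max_j |a_j|$ for $Q = \sum_j a_j t^j$. A polynomial path is a continuous function $\mathcal{P} : [0,1] \to \mathbb{C}_n[t]$, $\alpha \mapsto \mathcal{P}_\alpha$. A $\mathcal{P}$-root-path set is a multiset $\{\gamma_1, \dots, \gamma_n\}$ of continuous functions $[0,1] \to \mathbb{C}$ such that, for every $\alpha \in [0,1]$, the multiset of roots of $\mathcal{P}_\alpha$, counted with multiplicity, is $\{\gamma_1(\alpha), \dots, \gamma_n(\alpha)\}$. Theorem. Let $\varepsilon > 0$ and let $\mathcal{P} : [0,1] \to \mathbb{C}_n[t]$ be a polynomial path. Then there is a $\delta > 0$ such that for any polynomial path $\mathcal{P}' : [0,1] \to \mathbb{C}_n[t]$ with $\|\mathcal{P}_\alpha - \mathcal{P}'_\alpha\| < \delta$ for all $\alpha \in [0,1]$ and any $\mathcal{P}'$-root-path set $\{\gamma'_1, \dots, \gamma'_n\}$, there is a $\mathcal{P}$-root-path set $\{\gamma_1, \dots, \gamma_n\}$ satisfying $|\gamma_j(\alpha)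 - \gamma'_j(\alpha)| < \varepsilon$ for all $\alpha \in [0,1]$ and all $j = 1, \dots, n$. -/

import Mathlib

open Polynomial

noncomputable section

/-- The set of univariate complex monic polynomials of degree `n`. -/
def MonicPoly (n : ℕ) : Type := {p : ℂ[X] // p.Monic ∧ p.natDegree = n}

namespace MonicPoly

/-- The underlying polynomial. -/
def poly {n : ℕ} (p : MonicPoly n) : ℂ[X] := p.1

/-- The metric coming from the norm `max_j |a_j|` of the coefficients; `Polynomial.supNorm` is
the maximum of the absolute values of the coefficients. -/
instance metricSpace (n : ℕ) : MetricSpace (MonicPoly n) where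
  dist p q := (p.poly - q.poly).supNorm
  dist_self p := by simp
  dist_comm p q := by
    rw [supNorm_eq_iSup, supNorm_eq_iSup]
    simp only [coeff_sub, norm_sub_rev]
  dist_triangle p q r := by
    obtain ⟨i, hi⟩ := exists_eq_supNorm (p.poly - r.poly)
    have h1 := le_supNorm (p.poly - q.poly) i
    have h2 := le_supNorm (q.poly - r.poly) i
    rw [hi]
    simp only [coeff_sub] at h1 h2 ⊢
    exact (norm_sub_le_norm_sub_add_norm_sub _ _ _).trans (add_le_add h1 h2)
  eq_of_dist_eq_zero {p q} h := by
    apply Subtype.ext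
    exact sub_eq_zero.mp ((supNorm_eq_zero_iff _).mp h)

end MonicPoly

/-- A polynomial path: a continuous function from `[0,1]` to the monic complex polynomials of
degree `n`. -/
abbrev PolynomialPath (n : ℕ) : Type := C(unitInterval, MonicPoly n)

/-- The paths `γ 0, …, γ (n-1)` form a `P`-root-path set: for every `α ∈ [0,1]` the multiset of
roots of `P α`, with multiplicity, is the multiset `{γ 0 α, …, γ (n-1) α}`. A multiset of `n`
paths is given here by an enumeration of it. -/
def IsRootPathSet {n : ℕ} (P : PolynomialPath n) (γ : Fin n → C(unitInterval, ℂ)) : Prop :=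
  ∀ α : unitInterval, (P α).poly.roots = Finset.univ.val.map (fun j => γ j α)

end

/-! The proof is by compactness and contradiction. If no `δ` works, there are paths `Q k` converging
uniformly to `P` with root path sets `g k`, none `ε`-close to a root path set of `P`. Cauchy's bound
makes the `g k` uniformly bounded. They are also equicontinuous (`exists_root_oscillation_lt`): near
a parameter `a`, all roots of `Q k` lie in small disjoint discs around the roots of `P a`, and a
continuous path cannot jump between discs. By Arzelà–Ascoli a subsequence converges uniformly, and
its limit is a root path set of `P` (`IsRootPathSet.of_tendsto`), a contradiction. -/

namespace MonicPoly

variable {n : ℕ}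

lemma monic (p : MonicPoly n) : p.poly.Monic := p.2.1

lemma natDegree_eq (p : MonicPoly n) : p.poly.natDegree = n := p.2.2

lemma norm_coeff_sub_le_dist (p q : MonicPoly n) (i : ℕ) :
    ‖p.poly.coeff i - q.poly.coeff i‖ ≤ dist p q := by
  rw [← coeff_sub]
  exact le_supNorm _ i

/-- Roots of `q` are bounded in terms of `p` and the distance of `q` from `p`. -/
lemma norm_root_le (p q : MonicPoly n) {w : ℂ} (hw : w ∈ q.poly.roots) :
    ‖w‖ ≤ p.poly.supNorm + dist p q + 1 := by
  have hb : ‖w‖₊ < cauchyBound q.poly :=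
    (isRoot_of_mem_roots hw).norm_lt_cauchyBound q.monic.ne_zero
  have hs : cauchyBound q.poly ≤
      (show NNReal from
        ⟨p.poly.supNorm + dist p q, add_nonneg (supNorm_nonneg _) dist_nonneg⟩) + 1 := by
    rw [cauchyBound, q.monic.leadingCoeff, nnnorm_one, div_one]
    gcongr
    refine Finset.sup_le fun i _ => ?_
    rw [← NNReal.coe_le_coe]
    change ‖q.poly.coeff i‖ ≤ p.poly.supNorm + dist p q
    calc ‖q.poly.coeff i‖
        ≤ ‖p.poly.coeff i‖ + ‖p.poly.coeff i - q.poly.coeff i‖ := norm_le_norm_add_norm_sub _ _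
      _ ≤ _ := add_le_add (le_supNorm _ i) (norm_coeff_sub_le_dist p q i)
  exact NNReal.coe_le_coe.mpr (hb.le.trans hs)

lemma norm_eval_sub_eval_le (p q : MonicPoly n) {w : ℂ} {R : ℝ} (hR : 1 ≤ R) (hw : ‖w‖ ≤ R) :
    ‖p.poly.eval w - q.poly.eval w‖ ≤ (n + 1) * R ^ n * dist p q := by
  have hd : (p.poly - q.poly).natDegree < n + 1 :=
    Nat.lt_succ_of_le ((natDegree_sub_le _ _).trans (by rw [p.natDegree_eq, q.natDegree_eq]; simp))
  rw [← eval_sub, eval_eq_sum_range' hd]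
  calc _ ≤ ∑ i ∈ Finset.range (n + 1), ‖(p.poly - q.poly).coeff i * w ^ i‖ := norm_sum_le _ _
    _ ≤ ∑ i ∈ Finset.range (n + 1), dist p q * R ^ n := by
        refine Finset.sum_le_sum fun i hi => ?_
        rw [norm_mul, norm_pow]
        refine mul_le_mul (le_supNorm _ i) ?_ (by positivity) dist_nonneg
        calc ‖w‖ ^ i ≤ R ^ i := by gcongr
          _ ≤ R ^ n := pow_le_pow_right₀ hR (Nat.lt_succ_iff.mp (Finset.mem_range.mp hi))
    _ = _ := by simp; ring

lemma pow_card_le_prod_norm_sub {r : ℝ} (hr : 0 ≤ r) (w : ℂ) (s : Multiset ℂ)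
    (h : ∀ z ∈ s, r ≤ dist w z) : r ^ s.card ≤ ‖(s.map (w - ·)).prod‖ := by
  induction s using Multiset.induction_on with
  | empty => simp
  | cons a s ih =>
    rw [Multiset.card_cons, Multiset.map_cons, Multiset.prod_cons, norm_mul, pow_succ']
    exact mul_le_mul (by simpa [dist_eq_norm] using h a (by simp))
      (ih fun z hz => h z (Multiset.mem_cons_of_mem hz)) (by positivity) (norm_nonneg _)

/-- Roots of polynomials close to `p` are close to roots of `p`. -/
lemma exists_root_near (p : MonicPoly n) {r : ℝ} (hr : 0 < r) :
    ∃ δ > 0, ∀ q : MonicPoly n, dist p q < δ →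
      ∀ w ∈ q.poly.roots, ∃ z ∈ p.poly.roots, dist w z < r := by
  set R : ℝ := p.poly.supNorm + 2
  have hR : 1 ≤ R := by have := supNorm_nonneg p.poly; linarith
  have hc : (0 : ℝ) < (n + 1) * R ^ n := by positivity
  -- The bound `1` keeps `w` in the disc of radius `R`. The other bound forces `|p(w)| < r ^ n`,
  -- whereas `|p(w)| = ∏ |w - z| ≥ r ^ n` if every root `z` is at distance at least `r`.
  refine ⟨min 1 (r ^ n / ((n + 1) * R ^ n)), lt_min one_pos (by positivity), ?_⟩
  intro q hq w hw
  by_contra! hfar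
  have hwR : ‖w‖ ≤ R := by
    have := norm_root_le p q hw
    have := hq.trans_le (min_le_left _ _)
    linarith
  have hsplit := IsAlgClosed.splits p.poly
  have h1 := pow_card_le_prod_norm_sub hr.le w _ hfar
  rw [← hsplit.eval_eq_prod_roots_of_monic p.monic, ← hsplit.natDegree_eq_card_roots,
    p.natDegree_eq] at h1
  have h2 := norm_eval_sub_eval_le p q hR hwR
  rw [(isRoot_of_mem_roots hw).eq_zero, sub_zero] at h2
  have h3 := (lt_div_iff₀' hc).mp (hq.trans_le (min_le_right _ _))
  linarith

end MonicPoly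

/-- A continuous map on a preconnected set whose values stay within `r` of a `2r`-separated set
stays in a single ball. -/
lemma IsPreconnected.dist_lt_of_separated {X E : Type*} [TopologicalSpace X]
    [PseudoMetricSpace E] {S : Set X} (hS : IsPreconnected S) {f : X → E} (hf : ContinuousOn f S)
    {Z : Set E} {r : ℝ} (hsep : ∀ z ∈ Z, ∀ z' ∈ Z, z ≠ z' → 2 * r ≤ dist z z')
    (hnear : ∀ x ∈ S, ∃ z ∈ Z, dist (f x) z < r) {x y : X} (hx : x ∈ S) (hy : y ∈ S) :
    dist (f x) (f y) < 2 * r := by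
  obtain ⟨z, hz, hxz⟩ := hnear x hx
  have hdisj : Disjoint (Metric.ball z r) (⋃ z' ∈ Z \ {z}, Metric.ball z' r) := by
    refine Set.disjoint_iUnion₂_right.mpr fun z' hz' => Metric.ball_disjoint_ball ?_
    have := hsep z hz z' hz'.1 (Ne.symm hz'.2)
    linarith
  have hsub : f '' S ⊆ Metric.ball z r := by
    refine IsPreconnected.subset_left_of_subset_union Metric.isOpen_ball
      (isOpen_biUnion fun _ _ => Metric.isOpen_ball) hdisj ?_ ⟨f x, ⟨x, hx, rfl⟩, hxz⟩
      (hS.image f hf)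
    rintro _ ⟨u, hu, rfl⟩
    obtain ⟨z', hz', huz⟩ := hnear u hu
    by_cases h : z' = z
    · exact Or.inl (h ▸ huz)
    · exact Or.inr (Set.mem_biUnion (show z' ∈ Z \ {z} from ⟨hz', h⟩) huz)
  have hyz : dist (f y) z < r := hsub ⟨y, hy, rfl⟩
  linarith [dist_triangle_right (f x) (f y) z]

lemma Set.Finite.exists_separation {E : Type*} [MetricSpace E] {Z : Set E} (hZ : Z.Finite)
    {e : ℝ} (he : 0 < e) :
    ∃ r, 0 < r ∧ 2 * r ≤ e ∧ ∀ z ∈ Z, ∀ z' ∈ Z, z ≠ z' → 2 * r ≤ dist z z' := by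
  have small : ∀ d : ℝ, 0 < d → ∀ᶠ r : ℝ in nhdsWithin 0 (Set.Ioi 0), 2 * r ≤ d := fun d hd => by
    filter_upwards [Ioo_mem_nhdsGT (half_pos hd)] with r hr
    linarith [hr.2]
  have hev : ∀ᶠ r : ℝ in nhdsWithin 0 (Set.Ioi 0),
      0 < r ∧ 2 * r ≤ e ∧ ∀ z ∈ Z, ∀ z' ∈ Z, z ≠ z' → 2 * r ≤ dist z z' := by
    refine Filter.Eventually.and self_mem_nhdsWithin ((small e he).and ?_)
    refine (Filter.eventually_all_finite hZ).mpr fun z _ =>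
      (Filter.eventually_all_finite hZ).mpr fun z' _ => ?_
    by_cases h : z = z'
    · exact Filter.Eventually.of_forall fun _ h' => (h' h).elim
    · exact (small _ (dist_pos.mpr h)).mono fun _ hr _ => hr
  exact hev.exists

lemma IsRootPathSet.mem_roots {n : ℕ} {P : PolynomialPath n} {γ : Fin n → C(unitInterval, ℂ)}
    (h : IsRootPathSet P γ) (j : Fin n) (α : unitInterval) : γ j α ∈ (P α).poly.roots := by
  rw [h α]
  exact Multiset.mem_map_of_mem _ (Finset.mem_univ j)

/-- Every path near `P` that moves only through roots varies little near a given parameter. -/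
lemma PolynomialPath.exists_root_oscillation_lt {n : ℕ} (P : PolynomialPath n) (a : unitInterval)
    {e : ℝ} (he : 0 < e) :
    ∃ η > 0, ∃ δ > 0, ∀ Q : PolynomialPath n, (∀ α, dist (P α) (Q α) < δ) →
      ∀ f : C(unitInterval, ℂ), (∀ α, f α ∈ (Q α).poly.roots) →
        ∀ x, dist x a < η → dist (f a) (f x) < e := by
  obtain ⟨r, hr, hre, hsep⟩ := (Multiset.finite_toSet (P a).poly.roots).exists_separation he
  obtain ⟨δ, hδ, hnear⟩ := (P a).exists_root_near hr
  -- Half of `δ` pays for moving from `P a` to `P y`, the other half for moving from `P y` to `Q y`.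
  obtain ⟨η, hη, hP⟩ := Metric.continuousAt_iff.mp P.continuous.continuousAt (δ / 2) (half_pos hδ)
  refine ⟨η, hη, δ / 2, half_pos hδ, fun Q hQ f hf x hx => ?_⟩
  refine (IsPreconnected.dist_lt_of_separated (isPreconnected_uIcc (a := a) (b := x))
    f.continuous.continuousOn hsep (fun y hy => ?_) Set.left_mem_uIcc
    Set.right_mem_uIcc).trans_le hre
  refine hnear (Q y) ?_ _ (hf y)
  have hya : dist y a < η := by
    refine lt_of_le_of_lt ?_ hx
    rw [Subtype.dist_eq, Subtype.dist_eq, Real.dist_eq, Real.dist_eq]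
    refine Set.abs_sub_left_of_mem_uIcc ?_
    rcases Set.mem_uIcc.mp hy with h | h
    · exact Set.mem_uIcc.mpr (Or.inl h)
    · exact Set.mem_uIcc.mpr (Or.inr h)
  have h1 := hP hya
  rw [dist_comm] at h1
  linarith [dist_triangle (P a) (P y) (Q y), hQ y]

/-- A pointwise limit of root path sets along a converging sequence of polynomial paths is a root
path set of the limit. -/
lemma IsRootPathSet.of_tendsto {n : ℕ} {P : PolynomialPath n} {Q : ℕ → PolynomialPath n}
    {g : ℕ → Fin n → C(unitInterval, ℂ)} {γ : Fin n → C(unitInterval, ℂ)}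
    (hQ : ∀ α, Filter.Tendsto (fun k => dist (P α) (Q k α)) Filter.atTop (nhds 0))
    (hg : ∀ k, IsRootPathSet (Q k) (g k))
    (hγ : ∀ j α, Filter.Tendsto (fun k => g k j α) Filter.atTop (nhds (γ j α))) :
    IsRootPathSet P γ := by
  intro α
  -- Values of polynomials pass to the limit, unlike multisets of roots, so the factorization is
  -- proved first and the roots are read off it.
  have key : (P α).poly = ((Finset.univ.val.map fun j => γ j α).map (X - C ·)).prod := by
    refine Polynomial.funext fun w => ?_
    have h1 : Filter.Tendsto (fun k => (Q k α).poly.eval w) Filter.atTop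
        (nhds ((P α).poly.eval w)) := by
      rw [tendsto_iff_norm_sub_tendsto_zero]
      have h0 : Filter.Tendsto (fun k => ((n : ℝ) + 1) * (max 1 ‖w‖) ^ n * dist (P α) (Q k α))
          Filter.atTop (nhds 0) := by
        simpa using (hQ α).const_mul (((n : ℝ) + 1) * (max 1 ‖w‖) ^ n)
      refine squeeze_zero (fun _ => norm_nonneg _) (fun k => ?_) h0
      rw [norm_sub_rev]
      exact (P α).norm_eval_sub_eval_le (Q k α) (le_max_left _ _) (le_max_right _ _)
    have h2 : Filter.Tendsto (fun k => ∏ j, (w - g k j α)) Filter.atTop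
        (nhds (∏ j, (w - γ j α))) :=
      tendsto_finsetProd _ fun j _ => tendsto_const_nhds.sub (hγ j α)
    have h3 : ∀ k, (Q k α).poly.eval w = ∏ j, (w - g k j α) := fun k => by
      rw [(IsAlgClosed.splits _).eval_eq_prod_roots_of_monic (Q k α).monic, hg k α,
        Multiset.map_map]
      rfl
    simp only [h3] at h1
    rw [tendsto_nhds_unique h1 h2, Multiset.map_map, eval_multiset_prod, Multiset.map_map]
    simp [Finset.prod]
  rw [key, roots_multiset_prod_X_sub_C]

/-- Root path sets of polynomial paths converging uniformly to `P` subconverge uniformly. -/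
lemma PolynomialPath.exists_subseq_tendsto {n : ℕ} {P : PolynomialPath n}
    {Q : ℕ → PolynomialPath n} {g : ℕ → Fin n → C(unitInterval, ℂ)}
    (hQ : ∀ δ > 0, ∀ᶠ k in Filter.atTop, ∀ α, dist (P α) (Q k α) < δ)
    (hQ1 : ∀ k α, dist (P α) (Q k α) < 1)
    (hg : ∀ k, IsRootPathSet (Q k) (g k)) :
    ∃ (γ : Fin n → C(unitInterval, ℂ)) (φ : ℕ → ℕ), StrictMono φ ∧
      ∀ e > 0, ∀ᶠ k in Filter.atTop, ∀ j α, dist (g (φ k) j α) (γ j α) < e := by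
  -- Bundling the `n` paths into one map to `ℂ ^ n` yields a single subsequence valid for all `j`.
  let F : ℕ → BoundedContinuousFunction unitInterval (Fin n → ℂ) := fun k =>
    BoundedContinuousFunction.mkOfCompact (ContinuousMap.pi (g k))
  obtain ⟨D, hD⟩ := (isCompact_range P.continuous).isBounded.subset_closedBall (P 0)
  let R : ℝ := (P 0).poly.supNorm + (D + 1) + 1
  have hbound : ∀ k α j, ‖g k j α‖ ≤ R := fun k α j => by
    refine ((P 0).norm_root_le (Q k α) ((hg k).mem_roots j α)).trans ?_
    have h1 : dist (P α) (P 0) ≤ D := hD ⟨α, rfl⟩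
    have h2 := dist_triangle (P 0) (P α) (Q k α)
    rw [dist_comm (P 0) (P α)] at h2
    have := hQ1 k α
    simp only [R]
    linarith
  have hequi : Equicontinuous ((↑) : Set.range F → unitInterval → Fin n → ℂ) := by
    intro a
    rw [Metric.equicontinuousAt_iff_right]
    intro e he
    obtain ⟨η, hη, δ, hδ, hosc⟩ := P.exists_root_oscillation_lt a he
    obtain ⟨K, hK⟩ := Filter.eventually_atTop.mp (hQ δ hδ)
    -- The oscillation bound only covers `k ≥ K`; the finitely many earlier maps are handled by
    -- their own continuity.
    have hsmall : ∀ᶠ x in nhds a, ∀ k ∈ Finset.range K, dist (F k a) (F k x) < e := by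
      refine (Filter.eventually_all_finset _).mpr fun k _ => ?_
      have := Metric.tendsto_nhds.mp ((F k).continuous.tendsto a) e he
      exact this.mono fun x hx => by rwa [dist_comm]
    filter_upwards [hsmall, Metric.ball_mem_nhds a hη] with x hx hxa
    rintro ⟨_, k, rfl⟩
    rcases lt_or_ge k K with hk | hk
    · exact hx k (Finset.mem_range.mpr hk)
    · exact (dist_pi_lt_iff he).mpr fun j =>
        hosc (Q k) (hK k hk) (g k j) ((hg k).mem_roots j) x hxa
  have hcomp : IsCompact (closure (Set.range F)) := by
    refine BoundedContinuousFunction.arzela_ascoli (Set.univ.pi fun _ => Metric.closedBall 0 R)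
      (isCompact_univ_pi fun _ => isCompact_closedBall _ _) _ ?_ hequi
    rintro _ α ⟨k, rfl⟩ j -
    exact mem_closedBall_zero_iff.mpr (hbound k α j)
  obtain ⟨G, -, φ, hφ, hlim⟩ := hcomp.tendsto_subseq fun k => subset_closure ⟨k, rfl⟩
  refine ⟨fun j => ⟨fun α => G α j, (continuous_apply j).comp G.continuous⟩, φ, hφ, ?_⟩
  intro e he
  filter_upwards [Metric.tendsto_nhds.mp hlim e he] with k hk j α
  exact (dist_le_pi_dist (F (φ k) α) (G α) j).trans_lt
    ((BoundedContinuousFunction.dist_coe_le_dist α).trans_lt hk)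

theorem mainTheorem7 (n : ℕ) (ε : ℝ) (hε : 0 < ε) (P : PolynomialPath n) :
    ∃ δ : ℝ, 0 < δ ∧
      ∀ P' : PolynomialPath n,
        (∀ α : unitInterval, ((P α).poly - (P' α).poly).supNorm < δ) →
        ∀ γ' : Fin n → C(unitInterval, ℂ), IsRootPathSet P' γ' →
          ∃ γ : Fin n → C(unitInterval, ℂ), IsRootPathSet P γ ∧
            ∀ (j : Fin n) (α : unitInterval), ‖γ j α - γ' j α‖ < ε := by
  by_contra hcon
  have hseq : ∀ k : ℕ, ∃ (Q : PolynomialPath n) (g : Fin n → C(unitInterval, ℂ)),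
      (∀ α, dist (P α) (Q α) < 1 / ((k : ℝ) + 1)) ∧ IsRootPathSet Q g ∧
        ¬ ∃ γ : Fin n → C(unitInterval, ℂ), IsRootPathSet P γ ∧
          ∀ (j : Fin n) (α : unitInterval), ‖γ j α - g j α‖ < ε := fun k => by
    by_contra hk
    refine hcon ⟨1 / ((k : ℝ) + 1), by positivity, fun Q hQ g hg => ?_⟩
    by_contra h
    exact hk ⟨Q, g, hQ, hg, h⟩
  choose Q g hQ hg hbad using hseq
  have hconv : ∀ δ > 0, ∀ᶠ k in Filter.atTop, ∀ α, dist (P α) (Q k α) < δ := fun δ hδ =>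
    (tendsto_one_div_add_atTop_nhds_zero_nat.eventually_lt_const hδ).mono
      fun k hk α => (hQ k α).trans hk
  have hQ1 : ∀ k α, dist (P α) (Q k α) < 1 := fun k α =>
    (hQ k α).trans_le (div_le_one_of_le₀ (by linarith [k.cast_nonneg (α := ℝ)]) (by positivity))
  obtain ⟨γ, φ, hφ, hlim⟩ := PolynomialPath.exists_subseq_tendsto hconv hQ1 hg
  have hγ : IsRootPathSet P γ := by
    refine IsRootPathSet.of_tendsto (Q := fun k => Q (φ k)) (g := fun k => g (φ k))
      (fun α => ?_) (fun k => hg (φ k)) (fun j α => ?_)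
    · refine Filter.Tendsto.comp (g := fun k => dist (P α) (Q k α)) ?_ hφ.tendsto_atTop
      refine Metric.tendsto_nhds.mpr fun e he => (hconv e he).mono fun k hk => ?_
      simpa using hk α
    · exact Metric.tendsto_nhds.mpr fun e he => (hlim e he).mono fun k hk => hk j α
  obtain ⟨k, hk⟩ := (hlim ε hε).exists
  refine hbad (φ k) ⟨γ, hγ, fun j α => ?_⟩
  rw [← dist_eq_norm, dist_comm]
  exact hk j α
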